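/- **Definitions.** An *arithmetical graph* $(G,M,R)$ consists of a finite connected multigraph $G$ without loops, with vertices $C_1,\dots,C_v$, a symmetric integer matrix $M=(c_{ij})$ such that for $i\ne j$ the entry $c_{ij}\ge 0$ is the number of edges of $G$ joining $C_i$ and $C_j$, and a vector $R={}^t(r_1,\dots,r_v)$ of positive integers with $\gcd(r_1,\dots,r_v)=1$ and $MR=0$; the integer $r_i$ is the *multiplicity* of $C_i$, and we write $(C_i,r_i)$ for the vertex with its multiplicity. It is an *arithmetical tree* if $G$ is a tree (in particular $c_{ij}\le 1$ for $i\neq j$). The *group of components* is the finite abelian group $\Phi(G)=\mathrm{Ker}({}^tR:\mathbb{Z}^v\to\mathbb{Z})/\mathrm{Im}(M:\mathbb{Z}^v\to\mathbb{Z}^v)$. For distinct vertices $(C,r)$, $(C',r')$, let $E(C,C')\in\Phi(G)$ be the class of the vector with entry $r'/\gcd(r,r')$ at $C$, entry $-r/\gcd(r,r')$ at $C'$, and zeros elsewhere. A *node* is a vertex of degree greater than $2$. Let $\ell$ be a prime. A tree $(G,M,R)$ satisfies *Condition $C_\ell$* if for every edge $e$ of $G$, with endpoints $(A,a)$ and $(B,b)$,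 all the multiplicities of the vertices of at least one of the two connected components of $G\setminus\{e\}$ are divisible by $\ell^{\mathrm{ord}_\ell(\gcd(a,b))}$. Let $C\neq C'$ be vertices of a tree $G$, and let $\mathcal P$ be the path in $G$ from $C$ to $C'$. Let $(D_1,r_{D_1}),\dots,(D_s,r_{D_s})$ be the nodes of $G$ on $\mathcal P\setminus\{C,C'\}$, and let $m_i$ be the greatest common divisor of the multiplicities of all vertices in the connected component containing $D_i$ of the graph obtained from $G$ by removing all edges of $\mathcal P$. Let $\lambda(C,C')$ be the power of $\ell$ with $\mathrm{ord}_\ell(\lambda(C,C'))=\max_{1\le i\le s}\mathrm{ord}_\ell(r_{D_i}/m_i)$, and $\lambda(C,C')=1$ if $s=0$. For an element $h$ of order $m$ of a finite abelian group $H$ (written additively), write $m=\ell^e m'$ with $\ell\nmid m'$ and $1=am'+b\ell^e$ with $a,b\in\mathbb Z$; the *$\ell$-part* of $h$ is $h_\ell=am'h$ (it does not depend on the choice of $a,b$, and is trivial if $\ell\nmid m$). An element $h\in H$ is *$\ell$-divisible* if $h=\ell g$ for some $g\in H$. **Theorem 8.3.** Let $(G,M,R)$ be an arithmetical tree and let $\ell$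 be any prime. Let $(C,r)$ and $(C',r')$ be two distinct vertices of $G$ such that $\ell\nmid rr'$. If $G$ satisfies Condition $C_\ell$, then the $\ell$-part of $E(C,C')$ has order $\lambda(C,C')$ in $\Phi(G)$. Moreover, if the $\ell$-part of $E(C,C')$ is not trivial, then it is not $\ell$-divisible in $\Phi(G)$. -/

import Mathlib

/-- The graph underlying an integer matrix `M`: two distinct vertices are adjacent when the
corresponding off-diagonal entry of `M` (the number of edges joining them) is positive. -/
def intersectionGraph {V : Type*} (M : Matrix V V ℤ) : SimpleGraph V :=
  SimpleGraph.fromRel (fun i j => 0 < M i j)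

/-- An arithmetical graph `(G, M, R)` with vertex set `V`. The intersection matrix `M` is symmetric
and, for `i ≠ j`, the vertices `i` and `j` are linked by exactly `M i j ≥ 0` edges of the (multi)graph
`G`, so that `G` is encoded by `M`. The graph is connected, the multiplicities `R` are positive
integers with greatest common divisor `1`, and `M R = 0`. -/
structure ArithmeticalGraph (V : Type*) [Fintype V] [DecidableEq V] where
  M : Matrix V V ℤ
  R : V → ℕ
  symm : M.IsSymm
  offDiag_nonneg : ∀ i j, i ≠ j → 0 ≤ M i j
  connected : (intersectionGraph M).Connected
  R_pos : ∀ i, 0 < R i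
  R_gcd : Finset.univ.gcd R = 1
  M_mulVec_R : M.mulVec (fun i => (R i : ℤ)) = 0

namespace ArithmeticalGraph

variable {V : Type*} [Fintype V] [DecidableEq V] (Γ : ArithmeticalGraph V)

/-- The graph `G`, with multiple edges forgotten. -/
def graph : SimpleGraph V := intersectionGraph Γ.M

/-- The multigraph `G` is a tree: no two vertices are joined by more than one edge, and the
underlying simple graph is a tree. -/
def IsTree : Prop := (∀ i j, i ≠ j → Γ.M i j ≤ 1) ∧ Γ.graph.IsTree

/-- The degree of a vertex, edges being counted with multiplicity. -/
def degree (i : V) : ℤ := ∑ j ∈ Finset.univ.erase i, Γ.M i j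

/-- A node is a vertex of degree greater than `2`. -/
def IsNode (i : V) : Prop := 2 < Γ.degree i

/-- The kernel of the map `ᵗR : ℤ^V → ℤ`, `x ↦ ∑ i, r_i x_i`. -/
def kerR : Submodule ℤ (V → ℤ) :=
  LinearMap.ker (∑ i, (Γ.R i : ℤ) • (LinearMap.proj i : (V → ℤ) →ₗ[ℤ] ℤ))

theorem mem_kerR (x : V → ℤ) : x ∈ Γ.kerR ↔ ∑ i, (Γ.R i : ℤ) * x i = 0 := by
  simp [kerR, LinearMap.mem_ker]

/-- The group of components `Φ(G) = Ker(ᵗR) / Im(M)`. -/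
abbrev Phi : Type _ :=
  Γ.kerR ⧸ (LinearMap.range Γ.M.mulVecLin).submoduleOf Γ.kerR

/-- The vector with entry `r' / gcd(r, r')` at `C` and `-r / gcd(r, r')` at `C'`, and zero entries
elsewhere, where `r`, `r'` are the multiplicities of `C`, `C'`. -/
def vecE (C C' : V) : V → ℤ :=
  Pi.single C ((Γ.R C' / Nat.gcd (Γ.R C) (Γ.R C') : ℕ) : ℤ)
    - Pi.single C' ((Γ.R C / Nat.gcd (Γ.R C) (Γ.R C') : ℕ) : ℤ)

theorem vecE_mem_kerR (C C' : V) : Γ.vecE C C' ∈ Γ.kerR := by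
  rw [mem_kerR]
  simp only [vecE, Pi.sub_apply, mul_sub, Finset.sum_sub_distrib, Pi.single_apply, mul_ite,
    mul_zero, Finset.sum_ite_eq', Finset.mem_univ, if_true]
  rw [sub_eq_zero]
  norm_cast
  rw [← Nat.mul_div_assoc _ (Nat.gcd_dvd_right _ _), ← Nat.mul_div_assoc _ (Nat.gcd_dvd_left _ _),
    mul_comm]

/-- The element `E(C, C')` of `Φ(G)` associated to the pair `(C, C')`. -/
def E (C C' : V) : Γ.Phi :=
  Submodule.Quotient.mk ⟨Γ.vecE C C', Γ.vecE_mem_kerR C C'⟩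

/-- Condition `C_ℓ` for a tree: for every edge `e = {A, B}`, with `a` the exponent of `ℓ` in
`gcd(r_A, r_B)`, all the multiplicities on at least one of the two connected components of
`G ∖ {e}` are divisible by `ℓ ^ a`. -/
def ConditionC (ℓ : ℕ) : Prop :=
  ∀ A B : V, Γ.graph.Adj A B →
    (∀ v, (Γ.graph.deleteEdges {s(A, B)}).Reachable A v →
      ℓ ^ padicValNat ℓ (Nat.gcd (Γ.R A) (Γ.R B)) ∣ Γ.R v) ∨
    (∀ v, (Γ.graph.deleteEdges {s(A, B)}).Reachable B v →
      ℓ ^ padicValNat ℓ (Nat.gcd (Γ.R A) (Γ.R B)) ∣ Γ.R v)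

open Classical in
/-- For a vertex `D` of the path `P`, the greatest common divisor of the multiplicities of all
vertices in the connected component containing `D` of the graph obtained from `G` by removing
all edges of `P`. -/
noncomputable def componentGcd {C C' : V} (P : Γ.graph.Walk C C') (D : V) : ℕ :=
  (Finset.univ.filter
    (fun v => (Γ.graph.deleteEdges {e | e ∈ P.edges}).Reachable D v)).gcd Γ.R

open Classical in
/-- The integer `λ(C, C')` attached to the path `P` from `C` to `C'`: the power of `ℓ` whose exponent
is the maximum of `ord_ℓ (r_D / m_D)` over all nodes `D` on `P` other than `C` and `C'`, where `m_D`
is the greatest common divisor `componentGcd P D`. It is `1` when there is no such node. -/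
noncomputable def lambda (ℓ : ℕ) {C C' : V} (P : Γ.graph.Walk C C') : ℕ :=
  ℓ ^ (Finset.univ.filter
    (fun D => D ∈ P.support ∧ D ≠ C ∧ D ≠ C' ∧ Γ.IsNode D)).sup
      (fun D => padicValNat ℓ (Γ.R D / Γ.componentGcd P D))

end ArithmeticalGraph

/-- The `ℓ`-part of an element `h` of finite order `m` of an abelian group. Writing `m = ℓ ^ e * m'`
with `ℓ ∤ m'` and `1 = a * m' + b * ℓ ^ e` (Bezout), it is `(a * m') • h`. It is trivial when
`ℓ ∤ m`. -/
noncomputable def ellPart {H : Type*} [AddCommGroup H] (ℓ : ℕ) (h : H) : H :=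
  (Nat.gcdA (addOrderOf h / ℓ ^ padicValNat ℓ (addOrderOf h)) (ℓ ^ padicValNat ℓ (addOrderOf h)) *
    ((addOrderOf h / ℓ ^ padicValNat ℓ (addOrderOf h) : ℕ) : ℤ)) • h

/-- An element `h` is divisible by `ℓ` in the abelian group `H`. -/
def IsEllDivisible {H : Type*} [AddCommGroup H] (ℓ : ℕ) (h : H) : Prop :=
  ∃ g : H, ℓ • g = h

/-! Upper bound on the order: the group of components embeds in the cokernel of `M`, where each edge
{A, B} gives r_B [A] = r_A [B] (`IsTree.R_smul_cls_eq`). Chaining such relations along the path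
multiplies by the multiplicity of the vertex passed, which is harmless when prime to ℓ. Condition
C_ℓ forbids two consecutive multiplicities divisible by ℓ, so each bad vertex D can be jumped over;
by `IsTree.smul_cls_eq_of_append` this costs only the factor r_D / m_D. Hence uλ kills E(C, C') for
some u prime to ℓ.

Lower bound: if λ ≠ 1, a node D attaining the maximum yields an integer vector K with M K divisible
by λ and K · `vecE` prime to ℓ (`IsTree.exists_dual_vector`). As `M` is symmetric, pairing with K
defines a homomorphism from the group of components to ℤ/λ sending E(C, C') to a unit. This gives
both the order of the ℓ-part and its indivisibility. -/

namespace ArithmeticalGraph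

variable {V : Type*} [Fintype V] [DecidableEq V] (Γ : ArithmeticalGraph V)

/-! ### Adjacency, and the branches cut off by an edge -/

theorem adj_iff {i j : V} : Γ.graph.Adj i j ↔ i ≠ j ∧ 0 < Γ.M i j := by
  have h : Γ.M j i = Γ.M i j := Γ.symm.apply i j
  simp [graph, intersectionGraph, SimpleGraph.fromRel_adj, h]

theorem M_eq_zero_of_not_adj {i j : V} (hij : i ≠ j) (h : ¬ Γ.graph.Adj i j) : Γ.M i j = 0 := by
  rw [adj_iff] at h
  have := Γ.offDiag_nonneg i j hij
  by_contra h0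
  exact h ⟨hij, by omega⟩

variable {Γ}

theorem IsTree.M_eq_one (hT : Γ.IsTree) {i j : V} (h : Γ.graph.Adj i j) : Γ.M i j = 1 := by
  have h1 := Γ.adj_iff.1 h
  have := hT.1 i j h1.1
  omega

variable (Γ)

/-- The set of vertices on the side of `B` when the edge `{A, B}` is removed. -/
def branch (A B : V) : Set V := {v | (Γ.graph.deleteEdges {s(A, B)}).Reachable B v}

theorem self_mem_branch (A B : V) : B ∈ Γ.branch A B := SimpleGraph.Reachable.refl _

variable {Γ}

theorem IsTree.disjoint_branch (hT : Γ.IsTree) {A B v : V} (h : Γ.graph.Adj A B)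
    (hA : v ∈ Γ.branch A B) : v ∉ Γ.branch B A := by
  intro hB
  have hb := SimpleGraph.isAcyclic_iff_forall_adj_isBridge.1 hT.2.isAcyclic h
  rw [SimpleGraph.isBridge_iff] at hb
  unfold branch at hB
  rw [Sym2.eq_swap] at hB
  exact hb (SimpleGraph.Reachable.trans hB (SimpleGraph.Reachable.symm hA))

theorem IsTree.not_mem_branch (hT : Γ.IsTree) {A B : V} (h : Γ.graph.Adj A B) :
    A ∉ Γ.branch A B := fun hA => hT.disjoint_branch h hA (Γ.self_mem_branch B A)

theorem mem_branch_iff_of_adj {A B v w : V} (h : Γ.graph.Adj v w) (hne : s(v, w) ≠ s(A, B)) :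
    v ∈ Γ.branch A B ↔ w ∈ Γ.branch A B := by
  have : (Γ.graph.deleteEdges {s(A, B)}).Adj v w := by
    rw [SimpleGraph.deleteEdges_adj]
    exact ⟨h, hne⟩
  exact ⟨fun hv => SimpleGraph.Reachable.trans hv this.reachable,
    fun hv => SimpleGraph.Reachable.trans hv this.symm.reachable⟩

theorem mem_branch_of_walk {A B u v : V} (p : Γ.graph.Walk u v) (hp : s(A, B) ∉ p.edges)
    (hu : u ∈ Γ.branch A B) : v ∈ Γ.branch A B := by
  induction p with
  | nil => exact hu
  | cons h p ih =>
    simp only [SimpleGraph.Walk.edges_cons, List.mem_cons, not_or] at hp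
    exact ih hp.2 ((mem_branch_iff_of_adj h (Ne.symm hp.1)).1 hu)

/-! ### Vectors supported on a branch -/

open Classical in
/-- The multiplicities on a branch, divided by a common divisor `d`, solve a system whose right hand
side is supported on the ends of the edge cut. -/
theorem IsTree.exists_mulVec_branch (hT : Γ.IsTree) {A B : V} (h : Γ.graph.Adj A B) {d a b : ℤ}
    (hd : d ≠ 0) (ha : (Γ.R A : ℤ) = d * a) (hb : (Γ.R B : ℤ) = d * b)
    (hdvd : ∀ v ∈ Γ.branch A B, d ∣ (Γ.R v : ℤ)) :
    ∃ x : V → ℤ, (∀ v ∉ Γ.branch A B, x v = 0) ∧ (∀ v ∈ Γ.branch A B, d * x v = Γ.R v) ∧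
      Γ.M.mulVec x = Pi.single A b - Pi.single B a := by
  refine ⟨fun v => if v ∈ Γ.branch A B then (Γ.R v : ℤ) / d else 0, fun v hv => if_neg hv,
    fun v hv => ?_, ?_⟩
  · simp only [if_pos hv]
    exact Int.mul_ediv_cancel' (hdvd v hv)
  have hAB : A ≠ B := h.ne
  have hx : ∀ v, d * (if v ∈ Γ.branch A B then (Γ.R v : ℤ) / d else 0)
      = (if v ∈ Γ.branch A B then 1 else 0) * (Γ.R v : ℤ) := by
    intro v
    split_ifs with hv
    · rw [Int.mul_ediv_cancel' (hdvd v hv), one_mul]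
    · simp
  funext v
  apply mul_left_cancel₀ hd
  have hrow := congrFun Γ.M_mulVec_R v
  simp only [Matrix.mulVec, dotProduct, Pi.zero_apply] at hrow ⊢
  rw [Finset.mul_sum]
  -- The indicator of the branch at w may be replaced by that at v, except across the cut edge,
  -- which gives the correction terms. Summed over w, the main term vanishes because M R = 0.
  have key : ∀ w, d * (Γ.M v w * (if w ∈ Γ.branch A B then (Γ.R w : ℤ) / d else 0)) =
      (if v ∈ Γ.branch A B then 1 else 0) * (Γ.M v w * (Γ.R w : ℤ)) +
      ((if v = A then (if w = B then (Γ.R B : ℤ) else 0) else 0) -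
        (if v = B then (if w = A then (Γ.R A : ℤ) else 0) else 0)) := by
    intro w
    rw [mul_left_comm, hx w]
    by_cases hvw : v = w
    · subst hvw
      have h1 : ¬ (v = A ∧ v = B) := fun h => hAB (h.1.symm.trans h.2)
      split_ifs <;> simp_all
    by_cases hadj : Γ.graph.Adj v w
    · by_cases he : s(v, w) = s(A, B)
      · have hA := hT.not_mem_branch h
        have hB := Γ.self_mem_branch A B
        rcases Sym2.eq_iff.1 he with ⟨rfl, rfl⟩ | ⟨rfl, rfl⟩
        · simp [hA, hB, hT.M_eq_one hadj, hAB]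
        · simp [hA, hB, hT.M_eq_one hadj, hAB.symm]
      · have h1 := mem_branch_iff_of_adj hadj he
        have h2 : ¬ (v = A ∧ w = B) := by rintro ⟨rfl, rfl⟩; exact he rfl
        have h3 : ¬ (v = B ∧ w = A) := by rintro ⟨rfl, rfl⟩; exact he Sym2.eq_swap
        rw [← ite_and, ← ite_and, if_neg h2, if_neg h3]
        simp only [h1]
        ring
    · have h2 : ¬ (v = A ∧ w = B) := by rintro ⟨rfl, rfl⟩; exact hadj h
      have h3 : ¬ (v = B ∧ w = A) := by rintro ⟨rfl, rfl⟩; exact hadj h.symm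
      rw [← ite_and, ← ite_and, if_neg h2, if_neg h3, Γ.M_eq_zero_of_not_adj hvw hadj]
      ring
  rw [Finset.sum_congr rfl fun w _ => key w, Finset.sum_add_distrib, ← Finset.mul_sum, hrow,
    Finset.sum_sub_distrib]
  simp only [Pi.sub_apply, Pi.single_apply, mul_sub, mul_ite, mul_zero, ← ha, ← hb]
  split_ifs <;> simp

/-! ### Branches hanging off a path -/

/-- Since P avoids the edge Dw, it lies entirely on the side of D, so a walk inside the branch of w
uses no edge of P. -/
theorem IsTree.reachable_of_mem_branch (hT : Γ.IsTree) {C C' D w v : V} (P : Γ.graph.Walk C C')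
    (hD : D ∈ P.support) (hw : Γ.graph.Adj D w) (he : s(D, w) ∉ P.edges)
    (hv : v ∈ Γ.branch D w) : (Γ.graph.deleteEdges {e | e ∈ P.edges}).Reachable D v := by
  have hDx : ∀ x ∈ P.support, x ∈ Γ.branch w D := by
    have he' : s(w, D) ∉ P.edges := by rwa [Sym2.eq_swap]
    have hC : C ∈ Γ.branch w D := by
      refine mem_branch_of_walk (P.takeUntil D hD).reverse ?_ (Γ.self_mem_branch w D)
      rw [SimpleGraph.Walk.edges_reverse, List.mem_reverse]
      exact fun h => he' (P.edges_takeUntil_subset_edges hD h)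
    intro x hx
    exact mem_branch_of_walk (P.takeUntil x hx) (fun h => he' (P.edges_takeUntil_subset_edges hx h)) hC
  have h1 : (Γ.graph.deleteEdges {e | e ∈ P.edges}).Reachable D w := by
    apply SimpleGraph.Adj.reachable
    rw [SimpleGraph.deleteEdges_adj]
    exact ⟨hw, he⟩
  refine h1.trans ?_
  obtain ⟨q⟩ := hv
  have hq : ∀ x ∈ q.support, x ∈ Γ.branch D w := fun x hx => (q.takeUntil x hx).reachable
  refine ((q.mapLe (SimpleGraph.deleteEdges_le _)).toDeleteEdges _ fun e heq heP => ?_).reachable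
  rw [SimpleGraph.Walk.edges_mapLe_eq_edges] at heq
  induction e with
  | h a b =>
    exact hT.disjoint_branch hw (hq a (q.fst_mem_support_of_mem_edges heq))
      (hDx a (P.fst_mem_support_of_mem_edges heP))

theorem exists_mem_branch_of_reachable {C C' D v : V} (P : Γ.graph.Walk C C') (hne : v ≠ D)
    (hv : (Γ.graph.deleteEdges {e | e ∈ P.edges}).Reachable D v) :
    ∃ w, Γ.graph.Adj D w ∧ s(D, w) ∉ P.edges ∧ v ∈ Γ.branch D w := by
  -- A simple path never returns to D, so after its first edge Dw it stays in the branch of w.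
  obtain ⟨q, hq⟩ := hv.exists_isPath
  cases q with
  | nil => exact absurd rfl hne
  | @cons _ w _ h q =>
    rw [SimpleGraph.Walk.cons_isPath_iff] at hq
    have h' := h
    rw [SimpleGraph.deleteEdges_adj] at h'
    refine ⟨w, h'.1, h'.2, ?_⟩
    refine mem_branch_of_walk (q.mapLe (SimpleGraph.deleteEdges_le _)) ?_ (Γ.self_mem_branch D w)
    rw [SimpleGraph.Walk.edges_mapLe_eq_edges]
    exact fun he => hq.2 (q.fst_mem_support_of_mem_edges he)

theorem mem_branch_of_append {C C' A B : V} {p : Γ.graph.Walk C A} {h : Γ.graph.Adj A B}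
    {q : Γ.graph.Walk B C'} (hP : (p.append (.cons h q)).IsPath) :
    C ∈ Γ.branch B A ∧ C' ∈ Γ.branch A B := by
  have hn := hP.isTrail.edges_nodup
  rw [SimpleGraph.Walk.edges_append, SimpleGraph.Walk.edges_cons, List.nodup_append] at hn
  obtain ⟨-, h2, h3⟩ := hn
  rw [List.nodup_cons] at h2
  refine ⟨mem_branch_of_walk p.reverse ?_ (Γ.self_mem_branch B A),
    mem_branch_of_walk q h2.1 (Γ.self_mem_branch A B)⟩
  rw [SimpleGraph.Walk.edges_reverse, List.mem_reverse, Sym2.eq_swap]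
  exact fun h => h3 _ h _ (by simp) rfl

/-! ### Relations between vertex classes in the cokernel of `M` -/

variable (Γ)

/-- The class of a vertex in the cokernel of `M`. -/
def cls (v : V) : (V → ℤ) ⧸ LinearMap.range Γ.M.mulVecLin :=
  Submodule.Quotient.mk (Pi.single v 1)

theorem mk_single (v : V) (a : ℤ) :
    (Submodule.Quotient.mk (Pi.single v a) : (V → ℤ) ⧸ LinearMap.range Γ.M.mulVecLin)
      = a • Γ.cls v := by
  rw [cls, ← Submodule.Quotient.mk_smul]
  congr 1
  rw [← Pi.single_smul, smul_eq_mul, mul_one]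

theorem sum_smul_cls (D : V) : ∑ w, Γ.M D w • Γ.cls w = 0 := by
  have h : (Submodule.Quotient.mk (Γ.M.mulVecLin (Pi.single D 1)) :
      (V → ℤ) ⧸ LinearMap.range Γ.M.mulVecLin) = 0 :=
    (Submodule.Quotient.mk_eq_zero _).2 ⟨_, rfl⟩
  rw [← h, ← Finset.univ_sum_single (Γ.M.mulVecLin (Pi.single D 1)), ← Submodule.mkQ_apply,
    map_sum]
  refine Finset.sum_congr rfl fun w _ => ?_
  rw [Submodule.mkQ_apply, mk_single]
  simp only [Matrix.mulVecLin_apply, Matrix.mulVec_single_one, Matrix.col_apply]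
  rw [Γ.symm.apply D w]

variable {Γ}

/-- The cokernel may have torsion, so the factor d cannot be cancelled from the edge relation; it is
the divisibility on the whole branch that allows the division. -/
theorem IsTree.smul_cls_eq (hT : Γ.IsTree) {A B : V} (h : Γ.graph.Adj A B) {d a b : ℤ}
    (hd : d ≠ 0) (ha : (Γ.R A : ℤ) = d * a) (hb : (Γ.R B : ℤ) = d * b)
    (hdvd : ∀ v ∈ Γ.branch A B, d ∣ (Γ.R v : ℤ)) : b • Γ.cls A = a • Γ.cls B := by
  obtain ⟨x, -, -, hx⟩ := hT.exists_mulVec_branch h hd ha hb hdvd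
  rw [← sub_eq_zero, ← mk_single, ← mk_single, ← Submodule.Quotient.mk_sub, ← hx]
  exact (Submodule.Quotient.mk_eq_zero _).2 ⟨x, rfl⟩

theorem IsTree.R_smul_cls_eq (hT : Γ.IsTree) {A B : V} (h : Γ.graph.Adj A B) :
    (Γ.R B : ℤ) • Γ.cls A = (Γ.R A : ℤ) • Γ.cls B :=
  hT.smul_cls_eq h one_ne_zero (one_mul _).symm (one_mul _).symm fun _ _ => one_dvd _

theorem componentGcd_dvd {C C' D v : V} (P : Γ.graph.Walk C C')
    (hv : (Γ.graph.deleteEdges {e | e ∈ P.edges}).Reachable D v) :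
    Γ.componentGcd P D ∣ Γ.R v :=
  Finset.gcd_dvd (by simpa using hv)

theorem componentGcd_dvd_self {C C' : V} (P : Γ.graph.Walk C C') (D : V) :
    Γ.componentGcd P D ∣ Γ.R D := componentGcd_dvd P (SimpleGraph.Reachable.refl _)

theorem dvd_componentGcd {C C' D : V} (P : Γ.graph.Walk C C') {d : ℕ}
    (h : ∀ v, (Γ.graph.deleteEdges {e | e ∈ P.edges}).Reachable D v → d ∣ Γ.R v) :
    d ∣ Γ.componentGcd P D :=
  Finset.dvd_gcd fun v hv => h v (by simpa using hv)

theorem componentGcd_pos {C C' : V} (P : Γ.graph.Walk C C') (D : V) :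
    0 < Γ.componentGcd P D := Nat.pos_of_dvd_of_pos (componentGcd_dvd_self P D) (Γ.R_pos D)

theorem mem_edges_of_append {C C' A D B : V} {p : Γ.graph.Walk C A} {hAD : Γ.graph.Adj A D}
    {hDB : Γ.graph.Adj D B} {q : Γ.graph.Walk B C'}
    (hP : (p.append (.cons hAD (.cons hDB q))).IsPath) {w : V}
    (hw : s(D, w) ∈ (p.append (.cons hAD (.cons hDB q))).edges) : w = A ∨ w = B := by
  have hn := hP.support_nodup
  rw [SimpleGraph.Walk.support_append, SimpleGraph.Walk.support_cons, List.tail_cons,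
    SimpleGraph.Walk.support_cons, List.nodup_append, List.nodup_cons] at hn
  rw [SimpleGraph.Walk.edges_append, SimpleGraph.Walk.edges_cons, SimpleGraph.Walk.edges_cons,
    List.mem_append, List.mem_cons, List.mem_cons] at hw
  rcases hw with hw | hw | hw | hw
  · exact absurd rfl (hn.2.2 _ (p.fst_mem_support_of_mem_edges hw) D (by simp))
  · rcases Sym2.eq_iff.1 hw with ⟨h, -⟩ | ⟨-, h⟩
    · exact absurd h hAD.ne.symm
    · exact Or.inl h
  · rcases Sym2.eq_iff.1 hw with ⟨-, h⟩ | ⟨h, -⟩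
    · exact Or.inr h
    · exact absurd h hDB.ne
  · exact absurd (q.fst_mem_support_of_mem_edges hw) hn.2.1.1

theorem ne_of_append {C C' A D B : V} {p : Γ.graph.Walk C A} {hAD : Γ.graph.Adj A D}
    {hDB : Γ.graph.Adj D B} {q : Γ.graph.Walk B C'}
    (hP : (p.append (.cons hAD (.cons hDB q))).IsPath) : A ≠ B := by
  have hn := hP.support_nodup
  rw [SimpleGraph.Walk.support_append, SimpleGraph.Walk.support_cons, List.tail_cons,
    SimpleGraph.Walk.support_cons, List.nodup_append] at hn
  exact hn.2.2 A p.end_mem_support B (by simp)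

theorem sum_eq_add_add_sum_erase {G : Type*} [AddCommGroup G] {A B : V} (hAB : A ≠ B) (f : V → G) :
    ∑ w, f w = f A + (f B + ∑ w ∈ (Finset.univ.erase A).erase B, f w) := by
  rw [← Finset.add_sum_erase _ f (Finset.mem_univ A),
    ← Finset.add_sum_erase _ f (Finset.mem_erase.2 ⟨hAB.symm, Finset.mem_univ B⟩)]

/-- With d = m_D and t = r_D / d, every neighbour w of D off the path satisfies t [w] = (r_w / d)
[D]. Multiplying row D of `M` by t thus leaves only [A], [B] and [D], and r_B [D] = r_D [B]
eliminates [D]. -/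
theorem IsTree.smul_cls_eq_of_append (hT : Γ.IsTree) {C C' A D B : V} {p : Γ.graph.Walk C A}
    {hAD : Γ.graph.Adj A D} {hDB : Γ.graph.Adj D B} {q : Γ.graph.Walk B C'}
    (hP : (p.append (.cons hAD (.cons hDB q))).IsPath) :
    ((Γ.R D / Γ.componentGcd (p.append (.cons hAD (.cons hDB q))) D : ℕ) : ℤ) •
      ((Γ.R B : ℤ) • Γ.cls A) =
    ((Γ.R D / Γ.componentGcd (p.append (.cons hAD (.cons hDB q))) D : ℕ) : ℤ) •
      ((Γ.R A : ℤ) • Γ.cls B) := by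
  set P := p.append (.cons hAD (.cons hDB q)) with hPdef
  have hDP : D ∈ P.support := by simp [hPdef]
  set d : ℤ := (Γ.componentGcd P D : ℤ) with hd
  have hd0 : d ≠ 0 := by
    have := componentGcd_pos P D
    omega
  set t : ℤ := ((Γ.R D / Γ.componentGcd P D : ℕ) : ℤ) with ht
  have hRD : (Γ.R D : ℤ) = d * t := by
    rw [hd, ht]
    exact_mod_cast (Nat.mul_div_cancel' (componentGcd_dvd_self P D)).symm
  have hAB := ne_of_append hP
  have side : ∀ w, Γ.graph.Adj D w → w ≠ A → w ≠ B →
      ∀ v ∈ Γ.branch D w, d ∣ (Γ.R v : ℤ) := by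
    intro w hw hwA hwB v hv
    have he : s(D, w) ∉ P.edges := fun he => (mem_edges_of_append hP he).elim hwA hwB
    exact Int.natCast_dvd_natCast.2
      (componentGcd_dvd P (hT.reachable_of_mem_branch P hDP hw he hv))
  set S := (Finset.univ.erase A).erase B with hS
  have hMA := hT.M_eq_one hAD.symm
  have hMB := hT.M_eq_one hDB
  set s : ℤ := ∑ w ∈ S, Γ.M D w * ((Γ.R w : ℤ) / d) with hs
  have hsd : s * d = -((Γ.R A : ℤ) + Γ.R B) := by
    have hrow := congrFun Γ.M_mulVec_R D
    simp only [Matrix.mulVec, dotProduct, Pi.zero_apply] at hrow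
    rw [sum_eq_add_add_sum_erase hAB, ← hS, hMA, hMB] at hrow
    have : s * d = ∑ w ∈ S, Γ.M D w * (Γ.R w : ℤ) := by
      rw [hs, Finset.sum_mul]
      refine Finset.sum_congr rfl fun w hw => ?_
      simp only [hS, Finset.mem_erase, Finset.mem_univ, and_true] at hw
      by_cases hwD : w = D
      · rw [mul_assoc, Int.ediv_mul_cancel]
        rw [hwD, hRD]
        exact dvd_mul_right _ _
      by_cases hadj : Γ.graph.Adj D w
      · rw [mul_assoc, Int.ediv_mul_cancel (side w hadj hw.2 hw.1 w (Γ.self_mem_branch D w))]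
      · simp [Γ.M_eq_zero_of_not_adj (Ne.symm hwD) hadj]
    linarith
  have hcls : t • Γ.cls A + t • Γ.cls B = -(s • Γ.cls D) := by
    have hsum := Γ.sum_smul_cls D
    rw [sum_eq_add_add_sum_erase hAB, ← hS, hMA, hMB] at hsum
    have h2 : ∑ w ∈ S, t • (Γ.M D w • Γ.cls w) = s • Γ.cls D := by
      rw [hs, Finset.sum_smul]
      refine Finset.sum_congr rfl fun w hw => ?_
      simp only [hS, Finset.mem_erase, Finset.mem_univ, and_true] at hw
      by_cases hwD : w = D
      · rw [hwD, hRD, Int.mul_ediv_cancel_left _ hd0, smul_smul, mul_comm]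
      by_cases hadj : Γ.graph.Adj D w
      · have hsw := side w hadj hw.2 hw.1
        have := hT.smul_cls_eq hadj hd0 hRD
          (Int.mul_ediv_cancel' (hsw w (Γ.self_mem_branch D w))).symm hsw
        rw [mul_smul, this, smul_comm]
      · simp [Γ.M_eq_zero_of_not_adj (Ne.symm hwD) hadj]
    have h3 := congrArg (t • ·) hsum
    simp only [smul_add, smul_zero, one_smul, Finset.smul_sum, h2] at h3
    rw [eq_neg_iff_add_eq_zero, add_assoc]
    exact h3
  have hDB' := hT.R_smul_cls_eq hDB
  rw [hRD] at hDB'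
  have hA : t • Γ.cls A = -(s • Γ.cls D) - t • Γ.cls B := eq_sub_of_add_eq hcls
  have hRA : (Γ.R A : ℤ) = -(s * d) - Γ.R B := by linarith
  have h4 : (Γ.R B : ℤ) • (t • Γ.cls A) = -(s • ((Γ.R B : ℤ) • Γ.cls D))
      - (Γ.R B : ℤ) • (t • Γ.cls B) := by
    rw [hA]
    module
  rw [smul_comm, h4, hDB', hRA]
  module

/-- An edge at D off the path would be a third edge, so the component of a non-node is {D}. This is
why only nodes enter λ. -/
theorem IsTree.componentGcd_eq_of_not_isNode (hT : Γ.IsTree) {C C' A D B : V}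
    {p : Γ.graph.Walk C A} {hAD : Γ.graph.Adj A D} {hDB : Γ.graph.Adj D B} {q : Γ.graph.Walk B C'}
    (hP : (p.append (.cons hAD (.cons hDB q))).IsPath) (hD : ¬ Γ.IsNode D) :
    Γ.componentGcd (p.append (.cons hAD (.cons hDB q))) D = Γ.R D := by
  refine Nat.dvd_antisymm (componentGcd_dvd_self _ D) (dvd_componentGcd _ fun v hv => ?_)
  by_cases hvD : v = D
  · rw [hvD]
  exfalso
  obtain ⟨w, hw, he, -⟩ := exists_mem_branch_of_reachable _ hvD hv
  have hwA : w ≠ A := by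
    rintro rfl
    exact he (by simp [Sym2.eq_swap])
  have hwB : w ≠ B := by
    rintro rfl
    exact he (by simp)
  have hAB := ne_of_append hP
  apply hD
  have hsub : ({A, B, w} : Finset V) ⊆ Finset.univ.erase D := by
    intro x hx
    simp only [Finset.mem_insert, Finset.mem_singleton] at hx
    rcases hx with rfl | rfl | rfl
    · simp [hAD.ne]
    · simp [hDB.ne.symm]
    · simp [hw.ne.symm]
  have := Finset.sum_le_sum_of_subset_of_nonneg (f := fun j => Γ.M D j) hsub
    fun j hj _ => Γ.offDiag_nonneg D j (Finset.ne_of_mem_erase hj).symm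
  rw [Finset.sum_insert (by simp [hAB, hwA.symm]), Finset.sum_insert (by simp [hwB.symm]),
    Finset.sum_singleton, hT.M_eq_one hAD.symm, hT.M_eq_one hDB, hT.M_eq_one hw] at this
  rw [IsNode, degree]
  omega

/-! ### Upper bound: a multiple of λ prime to ℓ up to that factor kills E(C, C') -/

/-- Under Condition `C_ℓ`, two consecutive multiplicities on a path between vertices of multiplicity
prime to `ℓ` are not both divisible by `ℓ`. -/
theorem ConditionC.not_dvd_and_dvd {ℓ : ℕ} (hl : ℓ.Prime) (hC : Γ.ConditionC ℓ) {C C' A B : V}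
    (hrC : ¬ ℓ ∣ Γ.R C) (hrC' : ¬ ℓ ∣ Γ.R C') {p : Γ.graph.Walk C A} {h : Γ.graph.Adj A B}
    {q : Γ.graph.Walk B C'} (hP : (p.append (.cons h q)).IsPath) :
    ¬ (ℓ ∣ Γ.R A ∧ ℓ ∣ Γ.R B) := by
  rintro ⟨hA, hB⟩
  have := Fact.mk hl
  have hg : 1 ≤ padicValNat ℓ (Nat.gcd (Γ.R A) (Γ.R B)) :=
    one_le_padicValNat_of_dvd (Nat.gcd_pos_of_pos_left _ (Γ.R_pos A)).ne' (Nat.dvd_gcd hA hB)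
  have hdvd : ℓ ∣ ℓ ^ padicValNat ℓ (Nat.gcd (Γ.R A) (Γ.R B)) := dvd_pow_self _ (by omega)
  obtain ⟨h1, h2⟩ := mem_branch_of_append hP
  rcases hC A B h with h3 | h3
  · rw [branch, Sym2.eq_swap] at h1
    exact hrC (hdvd.trans (h3 C h1))
  · exact hrC' (hdvd.trans (h3 C' h2))

/-- Each node in the interior of the path contributes a divisor of `λ(C, C')`. -/
theorem pow_padicValNat_dvd_lambda {ℓ : ℕ} {C C' : V} (P : Γ.graph.Walk C C') {D : V}
    (h : D ∈ P.support) (h1 : D ≠ C) (h2 : D ≠ C') (h3 : Γ.IsNode D) :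
    ℓ ^ padicValNat ℓ (Γ.R D / Γ.componentGcd P D) ∣ Γ.lambda ℓ P := by
  classical
  unfold lambda
  refine pow_dvd_pow _ ?_
  exact Finset.le_sup (f := fun D => padicValNat ℓ (Γ.R D / Γ.componentGcd P D))
    (by simp only [Finset.mem_filter, Finset.mem_univ, true_and]; exact ⟨h, h1, h2, h3⟩)

theorem smul_cls_trans {ℓ : ℕ} (hl : ℓ.Prime) {X Y Z : V} {u u' : ℕ} {L : ℤ} (hu : ¬ ℓ ∣ u)
    (hu' : ¬ ℓ ∣ u') (hY : ¬ ℓ ∣ Γ.R Y)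
    (h : ((u : ℤ) * L) • ((Γ.R Y : ℤ) • Γ.cls X - (Γ.R X : ℤ) • Γ.cls Y) = 0)
    (h' : ((u' : ℤ) * L) • ((Γ.R Z : ℤ) • Γ.cls Y - (Γ.R Y : ℤ) • Γ.cls Z) = 0) :
    ∃ w : ℕ, ¬ ℓ ∣ w ∧
      ((w : ℤ) * L) • ((Γ.R Z : ℤ) • Γ.cls X - (Γ.R X : ℤ) • Γ.cls Z) = 0 := by
  refine ⟨u * u' * Γ.R Y, ?_, ?_⟩
  · rw [hl.dvd_mul, hl.dvd_mul]
    tauto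
  · have : (((u * u' * Γ.R Y : ℕ) : ℤ) * L) • ((Γ.R Z : ℤ) • Γ.cls X - (Γ.R X : ℤ) • Γ.cls Z) =
      ((u' : ℤ) * Γ.R Z) • (((u : ℤ) * L) • ((Γ.R Y : ℤ) • Γ.cls X - (Γ.R X : ℤ) • Γ.cls Y)) +
      ((u : ℤ) * Γ.R X) • (((u' : ℤ) * L) • ((Γ.R Z : ℤ) • Γ.cls Y - (Γ.R Y : ℤ) • Γ.cls Z)) := by
      push_cast
      module
    rw [this, h, h', smul_zero, smul_zero, add_zero]

/-- Induction on a bound for the remaining length, rather than on the length, since a step advances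
by one edge or by two according to whether the next multiplicity is prime to ℓ. -/
theorem IsTree.exists_smul_cls_eq_zero (hT : Γ.IsTree) {ℓ : ℕ} (hl : ℓ.Prime)
    (hC : Γ.ConditionC ℓ) {C C' : V} (hrC : ¬ ℓ ∣ Γ.R C) (hrC' : ¬ ℓ ∣ Γ.R C')
    (P : Γ.graph.Walk C C') (hP : P.IsPath) (n : ℕ) :
    ∀ {A : V} (p : Γ.graph.Walk C A) (q : Γ.graph.Walk A C'), q.length ≤ n → P = p.append q →
      ¬ ℓ ∣ Γ.R A → ∃ u : ℕ, ¬ ℓ ∣ u ∧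
        ((u : ℤ) * (Γ.lambda ℓ P : ℤ)) • ((Γ.R C' : ℤ) • Γ.cls A - (Γ.R A : ℤ) • Γ.cls C') = 0 := by
  have := Fact.mk hl
  have h1l : ¬ ℓ ∣ 1 := by simpa using hl.one_lt.ne'
  induction n with
  | zero =>
    intro A p q hq hPq hA
    cases q with
    | nil => exact ⟨1, h1l, by simp⟩
    | cons h q => simp at hq
  | succ n ih =>
    intro A p q hq hPq hA
    cases q with
    | nil => exact ⟨1, h1l, by simp⟩
    | @cons _ D _ hAD q =>
      rw [SimpleGraph.Walk.length_cons] at hq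
      have hPq' : P = (p.concat hAD).append q := by
        rw [hPq, SimpleGraph.Walk.concat_append]
      by_cases hD : ℓ ∣ Γ.R D
      · cases q with
        | nil => exact absurd hD hrC'
        | @cons _ B _ hDB q =>
          rw [SimpleGraph.Walk.length_cons] at hq
          have hB : ¬ ℓ ∣ Γ.R B := by
            rw [hPq'] at hP
            exact fun hB => hC.not_dvd_and_dvd hl hrC hrC' hP ⟨hD, hB⟩
          obtain ⟨u, hu, huX⟩ := ih ((p.concat hAD).concat hDB) q (by omega)
            (by rw [hPq', SimpleGraph.Walk.concat_append _ hDB]) hB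
          set t := Γ.R D / Γ.componentGcd P D with ht
          have ht0 : t ≠ 0 := (Nat.div_pos (Nat.le_of_dvd (Γ.R_pos D) (componentGcd_dvd_self P D))
            (componentGcd_pos P D)).ne'
          have hdvd : ℓ ^ padicValNat ℓ t ∣ Γ.lambda ℓ P := by
            by_cases hN : Γ.IsNode D
            · refine pow_padicValNat_dvd_lambda P (by simp [hPq]) ?_ ?_ hN
              · rintro rfl; exact hrC hD
              · rintro rfl; exact hrC' hD
            · have : t = 1 := by
                rw [ht]
                subst hPq
                rw [hT.componentGcd_eq_of_not_isNode hP hN, Nat.div_self (Γ.R_pos D)]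
              simp [this]
          have htX : (t : ℤ) • ((Γ.R B : ℤ) • Γ.cls A - (Γ.R A : ℤ) • Γ.cls B) = 0 := by
            rw [smul_sub, sub_eq_zero]
            subst hPq
            exact hT.smul_cls_eq_of_append hP
          obtain ⟨c, hc⟩ := hdvd
          obtain ⟨t', ht'⟩ := (pow_padicValNat_dvd : ℓ ^ padicValNat ℓ t ∣ t)
          have ht'l : ¬ ℓ ∣ t' := by
            rintro ⟨k, rfl⟩
            refine pow_succ_padicValNat_not_dvd ht0 (p := ℓ) ⟨k, ?_⟩
            rw [pow_succ, mul_assoc]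
            exact ht'
          refine smul_cls_trans hl (u := t') ht'l hu hB ?_ huX
          -- Multiplying by t', the prime-to-ℓ part of t, makes t'λ a multiple of t.
          have : (t' : ℤ) * (Γ.lambda ℓ P : ℤ) = c * t := by
            norm_cast
            rw [hc, mul_comm t', mul_right_comm, ← ht', mul_comm]
          rw [this, mul_smul, htX, smul_zero]
      · obtain ⟨u, hu, huX⟩ := ih (p.concat hAD) q (by omega) hPq' hD
        refine smul_cls_trans hl (u := 1) h1l hu hD ?_ huX
        rw [hT.R_smul_cls_eq hAD, sub_self, smul_zero]

theorem smul_E_eq_zero_iff (C C' : V) (n : ℤ) :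
    n • Γ.E C C' = 0 ↔ n • Γ.vecE C C' ∈ LinearMap.range Γ.M.mulVecLin := by
  rw [E, ← Submodule.Quotient.mk_smul, Submodule.Quotient.mk_eq_zero]
  rfl

theorem gcd_smul_vecE (C C' : V) :
    ((Nat.gcd (Γ.R C) (Γ.R C') : ℕ) : ℤ) • Γ.vecE C C' =
      Pi.single C (Γ.R C' : ℤ) - Pi.single C' (Γ.R C : ℤ) := by
  rw [vecE, smul_sub, ← Pi.single_smul, ← Pi.single_smul, smul_eq_mul, smul_eq_mul,
    ← Nat.cast_mul, ← Nat.cast_mul, Nat.mul_div_cancel' (Nat.gcd_dvd_left _ _),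
    Nat.mul_div_cancel' (Nat.gcd_dvd_right _ _)]

theorem IsTree.exists_smul_E_eq_zero (hT : Γ.IsTree) {ℓ : ℕ} (hl : ℓ.Prime)
    (hC : Γ.ConditionC ℓ) {C C' : V} (hrC : ¬ ℓ ∣ Γ.R C) (hrC' : ¬ ℓ ∣ Γ.R C')
    (P : Γ.graph.Walk C C') (hP : P.IsPath) :
    ∃ u : ℕ, ¬ ℓ ∣ u ∧ (u * Γ.lambda ℓ P) • Γ.E C C' = 0 := by
  obtain ⟨u, hu, h⟩ := hT.exists_smul_cls_eq_zero hl hC hrC hrC' P hP P.length .nil P le_rfl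
    (by simp) hrC
  -- The gcd clears the denominators in `vecE`; it divides r_C, hence is prime to ℓ.
  refine ⟨u * Nat.gcd (Γ.R C) (Γ.R C'), ?_, ?_⟩
  · rw [hl.dvd_mul]
    exact fun h' => h'.elim hu fun h' => hrC (h'.trans (Nat.gcd_dvd_left _ _))
  · rw [← natCast_zsmul, smul_E_eq_zero_iff]
    rw [← mk_single, ← mk_single, ← Submodule.Quotient.mk_sub, ← gcd_smul_vecE,
      ← Submodule.Quotient.mk_smul, Submodule.Quotient.mk_eq_zero, smul_smul] at h
    convert h using 2
    push_cast
    ring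

/-! ### Lower bound: dual vectors -/

theorem dotProduct_vecE (K : V → ℤ) (C C' : V) (hK : K C' = 0) :
    K ⬝ᵥ Γ.vecE C C' = K C * ((Γ.R C' / Nat.gcd (Γ.R C) (Γ.R C') : ℕ) : ℤ) := by
  rw [vecE, dotProduct_sub, dotProduct_single, dotProduct_single, hK, zero_mul, sub_zero]

/-- Some v in the component of D has r_v with the same ℓ-adic valuation as m_D; w starts the branch
containing v. If r_w had larger valuation, Condition C_ℓ at Dw would force ℓ to divide r_C or raise
the valuation of r_v. -/
theorem IsTree.exists_side_neighbour (hT : Γ.IsTree) {ℓ : ℕ} (hl : ℓ.Prime)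
    (hC : Γ.ConditionC ℓ) {C C' D : V} (hrC : ¬ ℓ ∣ Γ.R C)
    (P : Γ.graph.Walk C C') (hD : D ∈ P.support)
    (ht : ℓ ∣ Γ.R D / Γ.componentGcd P D) :
    ∃ w, Γ.graph.Adj D w ∧ s(D, w) ∉ P.edges ∧
      (∀ v ∈ Γ.branch D w, ℓ ^ padicValNat ℓ (Γ.componentGcd P D) ∣ Γ.R v) ∧
      ¬ ℓ ^ (padicValNat ℓ (Γ.componentGcd P D) + 1) ∣ Γ.R w := by
  have := Fact.mk hl
  set m := Γ.componentGcd P D with hm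
  have hm0 : m ≠ 0 := (componentGcd_pos P D).ne'
  have hnot : ¬ ℓ ^ (padicValNat ℓ m + 1) ∣ m := pow_succ_padicValNat_not_dvd hm0
  have hRD : ℓ ^ (padicValNat ℓ m + 1) ∣ Γ.R D := by
    rw [← Nat.mul_div_cancel' (componentGcd_dvd_self P D), pow_succ]
    exact mul_dvd_mul pow_padicValNat_dvd ht
  have hex : ∃ v, (Γ.graph.deleteEdges {e | e ∈ P.edges}).Reachable D v ∧
      ¬ ℓ ^ (padicValNat ℓ m + 1) ∣ Γ.R v := by
    by_contra! hcon
    exact hnot (dvd_componentGcd P hcon)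
  obtain ⟨v, hv, hvn⟩ := hex
  have hvD : v ≠ D := by
    rintro rfl
    exact hvn hRD
  obtain ⟨w, hw, he, hvw⟩ := exists_mem_branch_of_reachable P hvD hv
  have hbr : ∀ x ∈ Γ.branch D w, m ∣ Γ.R x := fun x hx =>
    componentGcd_dvd P (hT.reachable_of_mem_branch P hD hw he hx)
  refine ⟨w, hw, he, fun x hx => pow_padicValNat_dvd.trans (hbr x hx), fun hwd => ?_⟩
  have hg0 : Nat.gcd (Γ.R D) (Γ.R w) ≠ 0 := (Nat.gcd_pos_of_pos_left _ (Γ.R_pos D)).ne'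
  have hgd : ℓ ^ (padicValNat ℓ m + 1) ∣ ℓ ^ padicValNat ℓ (Nat.gcd (Γ.R D) (Γ.R w)) :=
    pow_dvd_pow _ ((padicValNat_dvd_iff_le hg0).1 (Nat.dvd_gcd hRD hwd))
  rcases hC D w hw with h | h
  · have hCm : C ∈ Γ.branch w D := by
      refine mem_branch_of_walk (P.takeUntil D hD).reverse ?_ (Γ.self_mem_branch w D)
      rw [SimpleGraph.Walk.edges_reverse, List.mem_reverse, Sym2.eq_swap]
      exact fun h => he (P.edges_takeUntil_subset_edges hD h)
    rw [branch, Sym2.eq_swap] at hCm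
    exact hrC ((dvd_pow_self _ (Nat.succ_ne_zero _)).trans (hgd.trans (h C hCm)))
  · exact hvn (hgd.trans (h v hvw))

theorem IsTree.exists_dual_vector (hT : Γ.IsTree) {ℓ : ℕ} (hl : ℓ.Prime)
    (hC : Γ.ConditionC ℓ) {C C' D : V} (hrC : ¬ ℓ ∣ Γ.R C) (hrC' : ¬ ℓ ∣ Γ.R C')
    (P : Γ.graph.Walk C C') (hP : P.IsPath) (hD : D ∈ P.support) (hDC : D ≠ C)
    (ht : ℓ ∣ Γ.R D / Γ.componentGcd P D) :
    ∃ K : V → ℤ, (∃ y : V → ℤ, Γ.M.mulVec K =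
        (ℓ ^ padicValNat ℓ (Γ.R D / Γ.componentGcd P D) : ℤ) • y) ∧
      ¬ (ℓ : ℤ) ∣ K ⬝ᵥ Γ.vecE C C' := by
  have := Fact.mk hl
  obtain ⟨w, hDw, he, hbr, hwn⟩ := hT.exists_side_neighbour hl hC hrC P hD ht
  have hendpoints : C ∈ Γ.branch w D ∧ C' ∈ Γ.branch w D := by
    constructor
    · refine mem_branch_of_walk (P.takeUntil D hD).reverse ?_ (Γ.self_mem_branch w D)
      rw [SimpleGraph.Walk.edges_reverse, List.mem_reverse, Sym2.eq_swap]
      exact fun h => he (P.edges_takeUntil_subset_edges hD h)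
    · refine mem_branch_of_walk (P.dropUntil D hD) ?_ (Γ.self_mem_branch w D)
      rw [Sym2.eq_swap]
      exact fun h => he (P.edges_dropUntil_subset_edges hD h)
  -- A is the predecessor of D on P, so the edge AD separates C from C'.
  obtain ⟨A, hAD, hCA, hC'A⟩ : ∃ A, Γ.graph.Adj A D ∧ C ∈ Γ.branch D A ∧ C' ∈ Γ.branch A D := by
    have hsp := P.take_spec hD
    revert hsp
    generalize P.takeUntil D hD = p
    generalize P.dropUntil D hD = q
    intro hsp
    cases p using SimpleGraph.Walk.concatRec with
    | Hnil => exact absurd rfl hDC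
    | Hconcat p h =>
      rw [SimpleGraph.Walk.concat_append] at hsp
      rw [← hsp] at hP
      exact ⟨_, h, mem_branch_of_append hP⟩
  set m := Γ.componentGcd P D with hm
  set k := padicValNat ℓ m with hk
  set t := padicValNat ℓ (Γ.R D / m) with ht'
  have hlk : ((ℓ : ℤ) ^ k) ≠ 0 := pow_ne_zero _ (by exact_mod_cast hl.ne_zero)
  obtain ⟨b, hb⟩ := hbr w (Γ.self_mem_branch D w)
  have hbl : ¬ ℓ ∣ b := by
    rintro ⟨c, rfl⟩
    exact hwn ⟨c, by rw [hb, pow_succ, mul_assoc]⟩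
  obtain ⟨a, ha⟩ : ℓ ^ k * ℓ ^ t ∣ Γ.R D := by
    rw [← Nat.mul_div_cancel' (componentGcd_dvd_self P D)]
    exact mul_dvd_mul pow_padicValNat_dvd pow_padicValNat_dvd
  have haZ : (Γ.R D : ℤ) = (ℓ : ℤ) ^ k * ((ℓ : ℤ) ^ t * a) := by
    rw [ha]
    push_cast
    ring
  obtain ⟨x, hx0, hx, hMx⟩ := hT.exists_mulVec_branch hAD.symm one_ne_zero (one_mul _).symm
    (one_mul _).symm (fun _ _ => one_dvd _)
  obtain ⟨y, hy0, hy, hMy⟩ := hT.exists_mulVec_branch hDw hlk haZ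
    (b := b) (by rw [hb]; push_cast; ring) (fun v hv => by exact_mod_cast hbr v hv)
  -- The coefficients cancel the entries of M x and M y at D, namely r_A and b. What remains sits at
  -- A and w, with entries divisible by ℓ^t. As y vanishes at C and C', and x at C', only b r_C
  -- enters the pairing.
  refine ⟨(b : ℤ) • x - (Γ.R A : ℤ) • y,
    ⟨(Γ.R A : ℤ) • Pi.single w (a : ℤ) - (b : ℤ) • Pi.single A ((ℓ : ℤ) ^ k * a), ?_⟩, ?_⟩
  · rw [Matrix.mulVec_sub, Matrix.mulVec_smul, Matrix.mulVec_smul, hMx, hMy]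
    funext v
    simp only [haZ, Pi.sub_apply, Pi.smul_apply, smul_eq_mul, Pi.single_apply, mul_sub, mul_ite,
      mul_zero]
    split_ifs <;> ring
  · have hyC := hy0 C fun h => hT.disjoint_branch hDw h hendpoints.1
    have hyC' := hy0 C' fun h => hT.disjoint_branch hDw h hendpoints.2
    have hxC' := hx0 C' fun h => hT.disjoint_branch hAD.symm h hC'A
    have hxC := hx C hCA
    rw [one_mul] at hxC
    rw [dotProduct_vecE _ _ _ (by simp [hyC', hxC'])]
    simp only [Pi.sub_apply, Pi.smul_apply, smul_eq_mul, hxC, hyC, mul_zero, sub_zero]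
    norm_cast
    rw [hl.dvd_mul, hl.dvd_mul]
    rintro ((h | h) | h)
    · exact hbl h
    · exact hrC h
    · exact hrC' (h.trans (Nat.div_dvd_of_dvd (Nat.gcd_dvd_right _ _)))

/-- The intersection pairing of `M K ∈ d ℤ^V` with an element of the image of `M` is divisible
by `d`. -/
theorem dvd_dotProduct_of_mem_range {K y z : V → ℤ} {d : ℤ} (hK : Γ.M.mulVec K = d • y)
    (hz : z ∈ LinearMap.range Γ.M.mulVecLin) : d ∣ K ⬝ᵥ z := by
  obtain ⟨x, rfl⟩ := hz
  rw [Matrix.mulVecLin_apply, Matrix.dotProduct_mulVec, ← Matrix.mulVec_transpose, Γ.symm.eq, hK,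
    smul_dotProduct]
  exact ⟨_, rfl⟩

/-- Both the lower bound for the order of `E(C, C')` and its indivisibility come from a vector of
`ℤ^V` annihilated by `M` modulo `λ(C, C')`. -/
theorem IsTree.exists_dual_vector_lambda (hT : Γ.IsTree) {ℓ : ℕ} (hl : ℓ.Prime)
    (hC : Γ.ConditionC ℓ) {C C' : V} (hrC : ¬ ℓ ∣ Γ.R C) (hrC' : ¬ ℓ ∣ Γ.R C')
    (P : Γ.graph.Walk C C') (hP : P.IsPath) (h1 : Γ.lambda ℓ P ≠ 1) :
    ℓ ∣ Γ.lambda ℓ P ∧ ∃ K y : V → ℤ, Γ.M.mulVec K = (Γ.lambda ℓ P : ℤ) • y ∧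
      ¬ (ℓ : ℤ) ∣ K ⬝ᵥ Γ.vecE C C' := by
  classical
  have hs : (Finset.univ.filter
      (fun D => D ∈ P.support ∧ D ≠ C ∧ D ≠ C' ∧ Γ.IsNode D)).Nonempty := by
    by_contra hs
    rw [Finset.not_nonempty_iff_eq_empty] at hs
    apply h1
    rw [lambda]
    have hs' : (Finset.univ.filter fun D => D ∈ P.support ∧ D ≠ C ∧ D ≠ C' ∧ Γ.IsNode D).sup
        (fun D => padicValNat ℓ (Γ.R D / Γ.componentGcd P D)) = 0 := by
      rw [hs, Finset.sup_empty]
      rfl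
    convert pow_zero ℓ
  obtain ⟨D, hD, hsup⟩ := Finset.exists_mem_eq_sup _ hs
    (fun D => padicValNat ℓ (Γ.R D / Γ.componentGcd P D))
  have hlam : Γ.lambda ℓ P = ℓ ^ padicValNat ℓ (Γ.R D / Γ.componentGcd P D) := by
    rw [lambda, ← hsup]
  have hpos : padicValNat ℓ (Γ.R D / Γ.componentGcd P D) ≠ 0 := by
    intro h0
    rw [h0, pow_zero] at hlam
    exact h1 hlam
  simp only [Finset.mem_filter, Finset.mem_univ, true_and] at hD
  obtain ⟨K, ⟨y, hy⟩, hK⟩ := hT.exists_dual_vector hl hC hrC hrC' P hP hD.1 hD.2.1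
    (dvd_of_one_le_padicValNat (Nat.one_le_iff_ne_zero.2 hpos))
  refine ⟨hlam ▸ dvd_pow_self _ hpos, K, y, ?_, hK⟩
  rw [hy, hlam]
  push_cast
  rfl

end ArithmeticalGraph

/-! ### The ℓ-part of an element, and the conclusion -/

/-- If `h` is killed by `u ℓ ^ k` with `ℓ ∤ u`, and its order is divisible by `ℓ ^ k`, then its
`ℓ`-part is a multiple of `h` and has order `ℓ ^ k`. -/
theorem addOrderOf_ellPart {H : Type*} [AddCommGroup H] {ℓ : ℕ} (hl : ℓ.Prime) {h : H} {u k : ℕ}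
    (hu : ¬ ℓ ∣ u) (h0 : (u * ℓ ^ k) • h = 0) (hdvd : ℓ ^ k ∣ addOrderOf h) :
    addOrderOf (ellPart ℓ h) = ℓ ^ k ∧
      ∃ a : ℤ, ellPart ℓ h = a • h ∧ (k ≠ 0 → ¬ (ℓ : ℤ) ∣ a) := by
  have := Fact.mk hl
  obtain ⟨m', hm'⟩ := hdvd
  have hlk : 0 < ℓ ^ k := pow_pos hl.pos _
  have hm'u : m' ∣ u := by
    have := addOrderOf_dvd_of_nsmul_eq_zero h0
    rw [hm', mul_comm u] at this
    exact Nat.dvd_of_mul_dvd_mul_left hlk this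
  have hlm' : ¬ ℓ ∣ m' := fun h => hu (h.trans hm'u)
  have hm'0 : m' ≠ 0 := by
    rintro rfl
    exact hlm' (dvd_zero _)
  have hval : padicValNat ℓ (addOrderOf h) = k := by
    rw [hm', padicValNat.mul hlk.ne' hm'0, padicValNat.prime_pow,
      padicValNat.eq_zero_of_not_dvd hlm', add_zero]
  have hdiv : addOrderOf h / ℓ ^ k = m' := by
    rw [hm', Nat.mul_div_cancel_left _ hlk]
  have hcop : Nat.Coprime m' (ℓ ^ k) := ((hl.coprime_iff_not_dvd.2 hlm').pow_left k).symm
  have hbez : (m' : ℤ) * Nat.gcdA m' (ℓ ^ k) + (ℓ : ℤ) ^ k * Nat.gcdB m' (ℓ ^ k) = 1 := by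
    have := Nat.gcd_eq_gcd_ab m' (ℓ ^ k)
    rw [hcop.gcd_eq_one] at this
    push_cast at this
    exact this.symm
  have hell : ellPart ℓ h = (Nat.gcdA m' (ℓ ^ k) * (m' : ℤ)) • h := by
    rw [ellPart, hval, hdiv]
  refine ⟨?_, _, hell, fun hk hd => ?_⟩
  · apply Nat.dvd_antisymm
    · apply addOrderOf_dvd_of_nsmul_eq_zero
      rw [hell, ← natCast_zsmul, smul_smul, ← addOrderOf_dvd_iff_zsmul_eq_zero, hm']
      push_cast
      exact ⟨Nat.gcdA m' (ℓ ^ k), by ring⟩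
    · have h1 := addOrderOf_nsmul_eq_zero (ellPart ℓ h)
      rw [hell, ← natCast_zsmul, smul_smul, ← addOrderOf_dvd_iff_zsmul_eq_zero, ← hell, hm'] at h1
      push_cast at h1
      have h2 : (ℓ : ℤ) ^ k ∣ (addOrderOf (ellPart ℓ h) : ℤ) *
          (Nat.gcdA m' (ℓ ^ k) * (m' : ℤ)) := (dvd_mul_right _ _).trans h1
      have h3 : (ℓ : ℤ) ^ k ∣ (addOrderOf (ellPart ℓ h) : ℤ) := by
        -- By Bezout the coefficient of h in its ℓ-part is 1 modulo ℓ^k, so it can be cancelled.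
        have h4 : (addOrderOf (ellPart ℓ h) : ℤ) = (addOrderOf (ellPart ℓ h) : ℤ) *
            (Nat.gcdA m' (ℓ ^ k) * (m' : ℤ)) +
            (ℓ : ℤ) ^ k * (Nat.gcdB m' (ℓ ^ k) * (addOrderOf (ellPart ℓ h) : ℤ)) := by
          linear_combination (-(addOrderOf (ellPart ℓ h) : ℤ)) * hbez
        rw [h4]
        exact dvd_add h2 (dvd_mul_right _ _)
      exact_mod_cast h3
  · have h1 : (ℓ : ℤ) ∣ 1 := by
      rw [← hbez]
      refine dvd_add (by rw [mul_comm]; exact hd) (Dvd.dvd.mul_right (dvd_pow_self _ hk) _)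
    exact (Nat.prime_iff_prime_int.1 hl).not_isUnit (isUnit_of_dvd_one h1)

theorem theorem8p3 {V : Type*} [Fintype V] [DecidableEq V] (Γ : ArithmeticalGraph V)
    (hT : Γ.IsTree) (ℓ : ℕ) (hl : ℓ.Prime) (hC : Γ.ConditionC ℓ)
    (C C' : V) (hCC' : C ≠ C') (hr : ¬ ℓ ∣ Γ.R C * Γ.R C')
    (P : Γ.graph.Walk C C') (hP : P.IsPath) :
    addOrderOf (ellPart ℓ (Γ.E C C')) = Γ.lambda ℓ P ∧
      (ellPart ℓ (Γ.E C C') ≠ 0 → ¬ IsEllDivisible ℓ (ellPart ℓ (Γ.E C C'))) := by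
  rw [hl.dvd_mul, not_or] at hr
  obtain ⟨hrC, hrC'⟩ := hr
  obtain ⟨u, hu, h0⟩ := hT.exists_smul_E_eq_zero hl hC hrC hrC' P hP
  have hdual := hT.exists_dual_vector_lambda hl hC hrC hrC' P hP
  have hdvd : Γ.lambda ℓ P ∣ addOrderOf (Γ.E C C') := by
    by_cases h1 : Γ.lambda ℓ P = 1
    · rw [h1]; exact one_dvd _
    obtain ⟨-, K, y, hy, hK⟩ := hdual h1
    have hmem := (Γ.smul_E_eq_zero_iff C C' (addOrderOf (Γ.E C C'))).1
      (by rw [natCast_zsmul, addOrderOf_nsmul_eq_zero])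
    have h2 := ArithmeticalGraph.dvd_dotProduct_of_mem_range hy hmem
    rw [dotProduct_smul, smul_eq_mul] at h2
    -- λ divides the order of E(C, C') times its pairing with K, and that pairing is prime to ℓ.
    have hcop : IsCoprime (Γ.lambda ℓ P : ℤ) (K ⬝ᵥ Γ.vecE C C') := by
      rw [ArithmeticalGraph.lambda]
      push_cast
      exact (((Nat.prime_iff_prime_int.1 hl).coprime_iff_not_dvd).2 hK).pow_left
    exact_mod_cast hcop.dvd_of_dvd_mul_right h2
  obtain ⟨k, hk⟩ : ∃ k, Γ.lambda ℓ P = ℓ ^ k := ⟨_, rfl⟩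
  rw [hk] at h0 hdvd
  obtain ⟨hord, a, ha, hal⟩ := addOrderOf_ellPart hl hu h0 hdvd
  refine ⟨hord.trans hk.symm, fun hne => ?_⟩
  rintro ⟨g, hg⟩
  have h1 : Γ.lambda ℓ P ≠ 1 := by
    intro h1
    rw [← hk, h1, AddMonoid.addOrderOf_eq_one_iff] at hord
    exact hne hord
  have hk0 : k ≠ 0 := by
    rintro rfl
    exact h1 hk
  obtain ⟨hlam, K, y, hy, hK⟩ := hdual h1
  induction g using Submodule.Quotient.induction_on with
  | H g =>
    rw [ha, ArithmeticalGraph.E, ← natCast_zsmul, ← Submodule.Quotient.mk_smul,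
      ← Submodule.Quotient.mk_smul, Submodule.Quotient.eq] at hg
    have hmem : (ℓ : ℤ) • (g : V → ℤ) - a • Γ.vecE C C' ∈ LinearMap.range Γ.M.mulVecLin := hg
    -- Modulo ℓ, pairing with K kills ℓg and the image of `M`, so ℓ would divide a (K · `vecE`), a
    -- product of two factors prime to ℓ.
    have h2 := (Int.natCast_dvd_natCast.2 hlam).trans
      (ArithmeticalGraph.dvd_dotProduct_of_mem_range hy hmem)
    rw [dotProduct_sub, dotProduct_smul, dotProduct_smul, smul_eq_mul, smul_eq_mul] at h2
    have h3 := (dvd_sub_right (dvd_mul_right _ _)).1 h2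
    exact ((Nat.prime_iff_prime_int.1 hl).dvd_or_dvd h3).elim (hal hk0) hK
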